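/- **Proposition 5.1.** Let $c>0$, $\gamma=\tfrac12\bigl(1+\sqrt{1+2c^4}\bigr)$, let $m\ge 0$ be an integer, $\sigma=2(m+\gamma)$, and let $z\in\mathbb C$ with $|z|<1$. For $k=0,1,2,\dots$ let $$\Phi_k^{\sigma,m}(z)=\sqrt{\frac{(\sigma-2m-1)\,\Gamma(\sigma-m)\,k!}{\pi\,m!\,\Gamma(\sigma-2m+k)}}\;\frac{(-1)^k\,\bar z^{\,m-k}}{(1-z\bar z)^m}\,P_k^{(m-k,\,\sigma-2m-1)}(1-2z\bar z)$$ with the Jacobi polynomials $P_k^{(\alpha,\beta)}$ (extended continuously to $z=0$), let $\mathcal N_{\sigma,m}(z)=\dfrac{\sigma-2m-1}{\pi(1-z\bar z)^{\sigma}}$, and for $\xi\ge 0$ let $$\varphi_k^\gamma(\xi)=\frac{\sqrt2\,i^\gamma (c^{-4})^{i\xi}\,\Gamma^2(\gamma+i\xi)}{\Gamma(i\xi)\,\Gamma(k+\gamma+\frac12)\sqrt{k!\,\Gamma(k+2\gamma)}}\,S_k\bigl(\xi^2;\gamma,\gamma,\tfrac12\bigr),$$ $$S_k(\xi^2;a,b,d)=(a+b)_k(a+d)_k\;{}_3F_2\!\left(\begin{matrix}-k,\;a+i\xi,\;a-i\xi\\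 a+b,\;a+d\end{matrix}\,\Big|\,1\right),$$ where $1/\Gamma(i\xi)=0$ for $\xi=0$. Then for every $\xi\ge0$ the series that defines the wave function of the coherent state, $$\varphi_{z,\gamma,m}(\xi)=\mathcal N_{\sigma,m}(z)^{-1/2}\sum_{k=0}^\infty\overline{\Phi_k^{\sigma,m}(z)}\,\varphi_k^\gamma(\xi),$$ converges absolutely, and $$\varphi_{z,\gamma,m}(\xi)=\frac{\sqrt{2\Gamma(m+2\gamma)}\,i^\gamma(c^{-4})^{i\xi}}{\Gamma(2\gamma)\,\Gamma(\gamma+\frac12)\sqrt{m!}}\,\frac{\Gamma^2(\gamma+i\xi)}{\Gamma(i\xi)}\,\frac{(1-z\bar z)^\gamma}{(1-\bar z)^{2\gamma}}\left(\frac{z-1}{1-\bar z}\right)^{m}F_5\!\left(\begin{matrix}\gamma+i\xi,&\gamma-i\xi:&2\gamma+m\\ .&\gamma+\frac12:&2\gamma\end{matrix}\,\Big|\,\frac{1-z\bar z}{(1-z)(\bar z-1)},\frac1{1-z}\right).$$ All complex powers have their principal values. Here $F_5$ is the special Appell–Kampé de Fériet function $$F_5\!\left(\begin{matrix}c_1,&d:&a\\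 .&e:&a'\end{matrix}\,\Big|\,\chi,\zeta\right)=\sum_{j,l\ge0}\frac{(c_1)_{j+l}(d)_{j+l}}{(e)_{j+l}}\,\frac{(a)_j}{(a')_j}\,\frac{\chi^j}{j!}\,\frac{\zeta^l}{l!}$$ near $(\chi,\zeta)=(0,0)$, continued analytically along the segment $t\mapsto(t\chi,t\zeta)$, $0\le t\le1$; this continuation exists for the parameters and arguments above. -/

import Mathlib

open Complex Filter Topology ComplexConjugate

noncomputable section

namespace RelBargmann

/-- The Pochhammer symbol `(a)_n = a (a+1) ⋯ (a+n-1)`. -/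
def poch (a : ℂ) (n : ℕ) : ℂ := ∏ j ∈ Finset.range n, (a + j)

/-- The Jacobi polynomial `P_n^{(α,β)}(x)` for arbitrary real parameters (negative integers
included), `P_n^{(α,β)}(x) = ∑_{l ≤ n} (n+α+β+1)_l (α+l+1)_{n-l} / (l! (n-l)!) ((x-1)/2)^l`. -/
def jacobiP (n : ℕ) (α β x : ℝ) : ℝ :=
  ∑ l ∈ Finset.range (n + 1),
    (∏ j ∈ Finset.range l, (n + α + β + 1 + j)) *
      (∏ j ∈ Finset.range (n - l), (α + l + 1 + j)) /
      ((l.factorial : ℝ) * ((n - l).factorial : ℝ)) * ((x - 1) / 2) ^ l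

/-- The continuous dual Hahn polynomial
`S_n(ξ²; a, b, c) = (a+b)_n (a+c)_n ₃F₂(-n, a+iξ, a-iξ; a+b, a+c; 1)`;
the `₃F₂`-series terminates at `j = n`. -/
def dualHahn (n : ℕ) (ξ a b c : ℝ) : ℂ :=
  poch (a + b) n * poch (a + c) n *
    ∑ j ∈ Finset.range (n + 1),
      poch (-n) j * poch (a + I * ξ) j * poch (a - I * ξ) j /
        (poch (a + b) j * poch (a + c) j * (j.factorial : ℂ))

/-- The function `Φ_k^{σ,m}` of the orthonormal basis of the `L²`-eigenspace of the `σ`-weight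
Maass Laplacian on the unit disk for the eigenvalue `4m(σ-m-1)`. At `z = 0` and `k > m` the power
`(conj z)^(m-k)` is `0` in Lean, so that the expression takes the value `0` there, which is its
limit as `z → 0` (the Jacobi polynomial then has a zero of order `k-m` at `1`). -/
def maassBasis (σ : ℝ) (m k : ℕ) (z : ℂ) : ℂ :=
  (Real.sqrt ((σ - 2 * m - 1) * Real.Gamma (σ - m) * (k.factorial : ℝ) /
      (Real.pi * (m.factorial : ℝ) * Real.Gamma (σ - 2 * m + k))) : ℂ) *
    ((-1) ^ k * (conj z) ^ ((m : ℤ) - (k : ℤ)) / ((1 - ‖z‖ ^ 2 : ℝ) : ℂ) ^ m) *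
    (jacobiP k ((m : ℝ) - k) (σ - 2 * m - 1) (1 - 2 * ‖z‖ ^ 2) : ℂ)

/-- The normalization factor `𝒩_{σ,m}(z) = (σ-2m-1) / (π (1-|z|²)^σ)`. -/
def normFactor (σ : ℝ) (m : ℕ) (z : ℂ) : ℝ :=
  (σ - 2 * m - 1) / (Real.pi * (1 - ‖z‖ ^ 2) ^ σ)

/-- The eigenstate `φ_k^γ` of the relativistic pseudoharmonic oscillator. Lean's values
`Γ(0) = 0` and `1/0 = 0` give `1/Γ(iξ)` its true value `0` at `ξ = 0`. -/
def oscState (c γ : ℝ) (k : ℕ) (ξ : ℝ) : ℂ :=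
  (Real.sqrt 2 : ℂ) * I ^ (γ : ℂ) * ((c ^ (-4 : ℤ) : ℝ) : ℂ) ^ (I * ξ) *
      Complex.Gamma (γ + I * ξ) ^ 2 * (Complex.Gamma (I * ξ))⁻¹ /
      ((Real.Gamma (k + γ + 1 / 2) *
        Real.sqrt ((k.factorial : ℝ) * Real.Gamma (k + 2 * γ)) : ℝ) : ℂ) *
    dualHahn k ξ γ γ (1 / 2)

/-- The `k`-th summand `conj (Φ_k^{σ,m}(z)) φ_k^γ(ξ)` of the coherent state. -/
def coherentTerm (c γ σ : ℝ) (m : ℕ) (z : ℂ) (ξ : ℝ) (k : ℕ) : ℂ :=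
  conj (maassBasis σ m k z) * oscState c γ k ξ

/-- The wave function of the coherent state,
`φ_{z,σ,γ,m}(ξ) = 𝒩_{σ,m}(z)^{-1/2} ∑_k conj (Φ_k^{σ,m}(z)) φ_k^γ(ξ)`. -/
def coherentState (c γ σ : ℝ) (m : ℕ) (z : ℂ) (ξ : ℝ) : ℂ :=
  ((normFactor σ m z ^ (-(1 / 2) : ℝ) : ℝ) : ℂ) * ∑' k : ℕ, coherentTerm c γ σ m z ξ k

/-- The term of index `(j, l)` of the Kampé de Fériet double series `F₅(c, d; e; a; a' | χ, ζ)`,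
`(c)_{j+l} (d)_{j+l} / (e)_{j+l} · (a)_j / (a')_j · χ^j / j! · ζ^l / l!`. -/
def f5Term (c d e a a' χ ζ : ℂ) (p : ℕ × ℕ) : ℂ :=
  poch c (p.1 + p.2) * poch d (p.1 + p.2) / poch e (p.1 + p.2) *
    (poch a p.1 / poch a' p.1) *
    (χ ^ p.1 / (p.1.factorial : ℂ)) * (ζ ^ p.2 / (p.2.factorial : ℂ))

/-- `g` continues `t ↦ F₅(… | tχ, tζ)` analytically along the segment `[0, 1]`: it is analytic on a
neighbourhood of the segment and is the sum of the double series for `t` near `0`. -/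
def IsF5Continuation (c d e a a' χ ζ : ℂ) (g : ℂ → ℂ) : Prop :=
  AnalyticOnNhd ℂ g (segment ℝ (0 : ℂ) 1) ∧
    ∀ᶠ t in 𝓝 (0 : ℂ), HasSum (f5Term c d e a a' (t * χ) (t * ζ)) (g t)

/-- The point `(χ, ζ)` lies in the star-shaped domain to which `F₅` extends analytically from the
origin along rays. -/
def F5Defined (c d e a a' χ ζ : ℂ) : Prop :=
  ∃ g : ℂ → ℂ, IsF5Continuation c d e a a' χ ζ g

open Classical in
/-- The Kampé de Fériet function `F₅(c, d; e; a; a' | χ, ζ)`: the sum of the double series near the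
origin, and elsewhere its analytic continuation along the ray from the origin to `(χ, ζ)`. -/
def F5 (c d e a a' χ ζ : ℂ) : ℂ :=
  if h : F5Defined c d e a a' χ ζ then h.choose 1 else 0

/-- The value of `F₅` does not depend on the choice of the continuation. -/
theorem F5_eq {c d e a a' χ ζ : ℂ} {g : ℂ → ℂ} (hg : IsF5Continuation c d e a a' χ ζ g) :
    F5 c d e a a' χ ζ = g 1 := by
  have h : F5Defined c d e a a' χ ζ := ⟨g, hg⟩
  have h0 : (0 : ℂ) ∈ segment ℝ (0 : ℂ) 1 := left_mem_segment ℝ _ _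
  have h1 : (1 : ℂ) ∈ segment ℝ (0 : ℂ) 1 := right_mem_segment ℝ _ _
  have hs := h.choose_spec
  rw [F5, dif_pos h]
  refine hs.1.eqOn_of_preconnected_of_eventuallyEq hg.1
    (convex_segment (0 : ℂ) 1).isPreconnected h0 ?_ h1
  filter_upwards [hs.2, hg.2] with t ht ht'
  exact ht.unique ht'

end RelBargmann

end

/-!
Write `a = γ + iξ`, `b = γ - iξ`, `e = γ + 1/2`. The numbers
`A_n = (a)_n (b)_n / ((2γ)_n (e)_n)` are the moments of a complex density on `[0, 1]`: they are
products of the moments `(a)_n / (a + b)_n` and `(b)_n / (e)_n` of two complex beta densities, with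
parameters `(a, b)` and `(b, 1/2 + iξ)`, so that `A_n = ∬ (xy)^n h(x, y)` over the unit square
(`integral_mul_pow_mul_betaDensity`). Both sides of the claim are integrals against `h`.

On the left, the Jacobi polynomials have the generating function
`∑ k, (-1)^k z^(m-k) P_k^{(m-k, 2γ-1)}(1 - 2|z|²) s^k = (1 - s conj z)^(-2γ-m) (z - s)^m`
(`zpow_mul_jacobiP_eq_diskCoeff`, `hasSum_diskCoeff`), absolutely convergent for `|s| ≤ 1`, and the
dual Hahn polynomial is `(2γ)_k (e)_k ∬ (1 - xy)^k h` (`dualHahn_eq_integral`). Hence the series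
converges absolutely and equals, up to constants, the integral of the generating function at
`s = 1 - xy` (`hasSum_diskCoeff_mul_integral`).

On the right, the double series of `F₅(tχ, tζ)` is `∑ n, A_n t^n c_n`, where
`∑ n, c_n s^n = (1 - sζ)^m (1 - s(χ + ζ))^(-2γ-m)` is a double binomial series (`hasSum_binomTerm`).
The integral of this kernel at `s = t x y` against `h` is analytic in `t` as long as
`Re (1 - t(χ + ζ)) > 0`, which holds on the segment `[0, 1]` since
`1 - (χ + ζ) = 1 / (1 - conj z)`; so it is the analytic continuation
(`isF5Continuation_of_moments`). At `t = 1` the two integrands agree up to the factor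
`(1 - conj z)^(-2γ-m) (z - 1)^m` (`disk_eq_f5Kernel`).
-/

noncomputable section

namespace RelBargmann

open MeasureTheory

/-! ### Rising factorials and binomial series -/

theorem poch_zero (a : ℂ) : poch a 0 = 1 := by simp [poch]

theorem poch_succ (a : ℂ) (n : ℕ) : poch a (n + 1) = poch a n * (a + n) :=
  Finset.prod_range_succ _ _

theorem poch_add (a : ℂ) (j l : ℕ) : poch a (j + l) = poch a j * poch (a + j) l := by
  simp only [poch, Finset.prod_range_add]
  congr 1
  exact Finset.prod_congr rfl fun i _ => by push_cast; ring

theorem poch_ne_zero {a : ℂ} (ha : 0 < a.re) (n : ℕ) : poch a n ≠ 0 := by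
  refine Finset.prod_ne_zero_iff.2 fun j _ h => ?_
  have := congrArg re h
  simp at this
  have : (0 : ℝ) ≤ j := j.cast_nonneg
  linarith

theorem ofReal_norm_poch {a : ℝ} (ha : 0 ≤ a) (n : ℕ) : ((‖poch a n‖ : ℝ) : ℂ) = poch a n := by
  have h : poch (a : ℂ) n = ((∏ j ∈ Finset.range n, (a + j) : ℝ) : ℂ) := by
    simp [poch]
  rw [h, norm_real, Real.norm_of_nonneg (Finset.prod_nonneg fun j _ => by positivity)]

/-- The coefficients of Mathlib's series of `1 / (1 - y) ^ a` in terms of `poch`. -/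
theorem multichoose_eq_poch_div (a : ℂ) (n : ℕ) :
    Ring.choose (a + n - 1) n = poch a n / (n.factorial : ℂ) := by
  have h := Ring.factorial_nsmul_multichoose_eq_ascPochhammer a n
  rw [nsmul_eq_mul] at h
  rw [eq_div_iff (by exact_mod_cast n.factorial_ne_zero), Ring.choose]
  rw [show a + n - 1 - n + 1 = a by ring, mul_comm, h]
  rw [Polynomial.ascPochhammer_smeval_eq_eval]
  clear h
  induction n with
  | zero => simp [poch]
  | succ n ih => rw [poch_succ, ← ih, ascPochhammer_succ_eval]

/-- The binomial series in rising-factorial form. -/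
theorem hasSum_poch (a : ℂ) {y : ℂ} (hy : ‖y‖ < 1) :
    HasSum (fun n : ℕ => poch a n / (n.factorial : ℂ) * y ^ n) ((1 - y) ^ (-a)) := by
  have h := (one_div_one_sub_cpow_hasFPowerSeriesOnBall_zero a).hasSum (y := y)
    (by simpa [enorm_eq_nnnorm] using! hy)
  simp only [zero_add] at h
  rw [cpow_neg, ← one_div]
  convert! h using 2 with n
  rw [FormalMultilinearSeries.ofScalars_apply_eq, multichoose_eq_poch_div, smul_eq_mul]

/-- For `a ≥ 0` the series of norms is the binomial series at `‖y‖`. -/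
theorem summable_norm_poch {a : ℝ} (ha : 0 ≤ a) {y : ℂ} (hy : ‖y‖ < 1) :
    Summable fun n : ℕ => ‖poch a n / (n.factorial : ℂ) * y ^ n‖ := by
  have h := (hasSum_poch a (y := (‖y‖ : ℂ)) (by simpa using hy)).summable
  refine Complex.summable_ofReal.1 ?_
  convert h using 2 with n
  simp [ofReal_norm_poch ha]

theorem abs_arg_lt_of_re_pos {x : ℂ} (hx : 0 < x.re) : |arg x| < Real.pi / 2 :=
  abs_arg_lt_pi_div_two_iff.2 (Or.inl hx)

theorem mul_cpow_of_re_pos {x y : ℂ} (hx : 0 < x.re) (hy : 0 < y.re) (s : ℂ) :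
    (x * y) ^ s = x ^ s * y ^ s := by
  have hx0 : x ≠ 0 := by rintro rfl; simp at hx
  have hy0 : y ≠ 0 := by rintro rfl; simp at hy
  have h1 := abs_lt.1 (abs_arg_lt_of_re_pos hx)
  have h2 := abs_lt.1 (abs_arg_lt_of_re_pos hy)
  rw [cpow_def_of_ne_zero (mul_ne_zero hx0 hy0), cpow_def_of_ne_zero hx0, cpow_def_of_ne_zero hy0,
    Complex.log_mul hx0 hy0 ⟨by linarith, by linarith⟩, add_mul, exp_add]

theorem re_one_sub_pos {y : ℂ} (hy : ‖y‖ < 1) : 0 < (1 - y).re := by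
  have := (re_le_norm y).trans_lt hy
  simpa using this

/-- The term of index `(j, l)` of the double binomial series
`(β)_j (α + j)_l x^j y^l / (j! l!)`. -/
def binomTerm (α β x y : ℂ) (p : ℕ × ℕ) : ℂ :=
  (poch β p.1 / (p.1.factorial : ℂ) * x ^ p.1) *
    (poch (α + p.1) p.2 / (p.2.factorial : ℂ) * y ^ p.2)

theorem hasSum_binomTerm_right (α β x : ℂ) {y : ℂ} (hy : ‖y‖ < 1) (j : ℕ) :
    HasSum (fun l => binomTerm α β x y (j, l))
      ((1 - y) ^ (-α) * (poch β j / (j.factorial : ℂ) * (x / (1 - y)) ^ j)) := by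
  have h0 : 1 - y ≠ 0 := fun h => by have := re_one_sub_pos hy; simp [h] at this
  have h := (hasSum_poch (α + j) hy).mul_left (poch β j / (j.factorial : ℂ) * x ^ j)
  have e : (1 - y) ^ (-(α + j)) = (1 - y) ^ (-α) * ((1 - y) ^ j)⁻¹ := by
    rw [neg_add, cpow_add _ _ h0, cpow_neg _ (j : ℂ), cpow_natCast]
  rw [e] at h
  convert! h using 1
  rw [div_pow]
  ring

theorem norm_div_one_sub_lt {x y : ℂ} (h : ‖x‖ + ‖y‖ < 1) : ‖x / (1 - y)‖ < 1 := by
  have h1 : 1 - ‖y‖ ≤ ‖1 - y‖ := by simpa using norm_sub_norm_le 1 y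
  have h2 := norm_nonneg x
  rw [norm_div, div_lt_one (by linarith)]
  linarith

theorem norm_binomTerm {α β : ℝ} (hα : 0 ≤ α) (hβ : 0 ≤ β) (x y : ℂ) (p : ℕ × ℕ) :
    ((‖binomTerm α β x y p‖ : ℝ) : ℂ) = binomTerm α β (‖x‖ : ℂ) (‖y‖ : ℂ) p := by
  have h := ofReal_norm_poch (show (0 : ℝ) ≤ α + p.1 by positivity) p.2
  push_cast at h
  simp [binomTerm, ofReal_norm_poch hβ, h]

theorem summable_norm_binomTerm {α β : ℝ} (hα : 0 ≤ α) (hβ : 0 ≤ β) {x y : ℂ}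
    (h : ‖x‖ + ‖y‖ < 1) : Summable fun p => ‖binomTerm α β x y p‖ := by
  have hy : ‖((‖y‖ : ℝ) : ℂ)‖ < 1 := by
    have := norm_nonneg x
    simp; linarith
  rw [summable_prod_of_nonneg fun p => norm_nonneg _]
  simp only [← Complex.summable_ofReal, ofReal_tsum, norm_binomTerm hα hβ]
  refine ⟨fun j => (hasSum_binomTerm_right _ _ _ hy j).summable, ?_⟩
  simp only [(hasSum_binomTerm_right _ _ _ hy _).tsum_eq]
  exact (hasSum_poch _ (norm_div_one_sub_lt (by simpa using h))).summable.mul_left _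

/-- Summing first over `l` and then over `j` gives `(1 - y)^(-α) (1 - x / (1 - y))^(-α - m)`; both
bases lie in the right half plane, so that the principal powers can be combined. -/
theorem hasSum_binomTerm {α : ℝ} (hα : 0 ≤ α) (m : ℕ) {x y : ℂ} (h : ‖x‖ + ‖y‖ < 1) :
    HasSum (binomTerm α (α + m) x y) ((1 - y) ^ m * (1 - (x + y)) ^ (-(α + m : ℂ))) := by
  have hy : ‖y‖ < 1 := by have := norm_nonneg x; linarith
  have hxy := norm_div_one_sub_lt h
  have h0 : 1 - y ≠ 0 := fun h => by have := re_one_sub_pos hy; simp [h] at this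
  have hs : Summable (binomTerm α (α + m) x y) := by
    have := summable_norm_binomTerm hα (show (0 : ℝ) ≤ α + m by positivity) h
    push_cast at this
    exact this.of_norm
  have h1 := hs.hasSum.prod_fiberwise fun j => hasSum_binomTerm_right α (α + m) x hy j
  have h2 := (hasSum_poch (α + m) hxy).mul_left ((1 - y) ^ (-α : ℂ))
  have h3 := hs.hasSum
  rw [h1.unique h2] at h3
  convert h3 using 1
  rw [show 1 - (x + y) = (1 - y) * (1 - x / (1 - y)) by field_simp; ring,
    mul_cpow_of_re_pos (re_one_sub_pos hy) (re_one_sub_pos hxy), neg_add, cpow_add _ _ h0,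
    cpow_neg _ (m : ℂ), cpow_natCast]
  field_simp

/-! ### The continuation of `F₅` as an integral -/

section Moments

variable {X : Type*} [MeasurableSpace X] {ν : Measure X} {u : X → ℝ} {h : X → ℂ}

theorem integrable_comp_mul (hum : Measurable u) (hu : ∀ᵐ x ∂ν, u x ∈ Set.Icc (0 : ℝ) 1)
    (hh : Integrable h ν) {f : ℂ → ℂ} (hfm : Measurable f)
    (hf : ContinuousOn f (segment ℝ (0 : ℂ) 1)) :
    Integrable (fun x => f (u x) * h x) ν := by
  have hK : IsCompact (segment ℝ (0 : ℂ) 1) := by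
    rw [← convexHull_pair]
    exact (Set.toFinite _).isCompact_convexHull ℝ
  obtain ⟨M, hM⟩ := hK.exists_bound_of_continuousOn hf
  refine hh.bdd_mul (c := M) (hfm.comp (measurable_ofReal.comp hum)).aestronglyMeasurable ?_
  filter_upwards [hu] with x hx
  refine hM _ ?_
  rw [segment_eq_image]
  exact ⟨u x, hx, by simp⟩

/-- A superposition of the dilations `t ↦ f (t r)`, `0 ≤ r ≤ 1`, of a holomorphic function on a
star-shaped open set is holomorphic there: on a compact neighbourhood of `t₀` the derivative of
`f` is bounded on the compact set of all `t r`, so that one may differentiate under the integral.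
-/
theorem differentiableOn_integral_comp_mul (hum : Measurable u)
    (hu : ∀ᵐ x ∂ν, u x ∈ Set.Icc (0 : ℝ) 1) (hh : Integrable h ν) {f : ℂ → ℂ}
    (hfm : Measurable f) {U : Set ℂ} (hU : IsOpen U)
    (hstar : ∀ t ∈ U, ∀ r ∈ Set.Icc (0 : ℝ) 1, t * r ∈ U) (hf : DifferentiableOn ℂ f U) :
    DifferentiableOn ℂ (fun t => ∫ x, f (t * u x) * h x ∂ν) U := by
  intro t₀ ht₀
  obtain ⟨ε, ε0, hε⟩ := Metric.nhds_basis_closedBall.mem_iff.1 (hU.mem_nhds ht₀)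
  have hK : IsCompact ((fun p : ℂ × ℝ => p.1 * (p.2 : ℂ)) ''
      (Metric.closedBall t₀ ε ×ˢ Set.Icc (0 : ℝ) 1)) :=
    ((isCompact_closedBall t₀ ε).prod isCompact_Icc).image (by fun_prop)
  have hKU : ((fun p : ℂ × ℝ => p.1 * (p.2 : ℂ)) ''
      (Metric.closedBall t₀ ε ×ˢ Set.Icc (0 : ℝ) 1)) ⊆ U := by
    rintro _ ⟨p, hp, rfl⟩
    exact hstar _ (hε hp.1) _ hp.2
  obtain ⟨M, hM⟩ := hK.exists_bound_of_continuousOn ((hf.deriv hU).continuousOn.mono hKU)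
  obtain ⟨M₀, hM₀⟩ := hK.exists_bound_of_continuousOn (hf.continuousOn.mono hKU)
  have hmem : ∀ t ∈ Metric.closedBall t₀ ε, ∀ r ∈ Set.Icc (0 : ℝ) 1, t * (r : ℂ) ∈
      (fun p : ℂ × ℝ => p.1 * (p.2 : ℂ)) '' (Metric.closedBall t₀ ε ×ˢ Set.Icc (0 : ℝ) 1) :=
    fun t ht r hr => ⟨(t, r), ⟨ht, hr⟩, rfl⟩
  have ht₀' : t₀ ∈ Metric.closedBall t₀ ε := Metric.mem_closedBall_self ε0.le
  have hmeas : ∀ {F : ℂ → ℂ}, Measurable F → ∀ t : ℂ,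
      AEStronglyMeasurable (fun x => F (t * u x)) ν := fun hF t =>
    (hF.comp (measurable_const.mul (measurable_ofReal.comp hum))).aestronglyMeasurable
  have key := hasDerivAt_integral_of_dominated_loc_of_deriv_le (μ := ν) (𝕜 := ℂ)
    (F := fun t x => f (t * u x) * h x) (F' := fun t x => deriv f (t * u x) * u x * h x)
    (x₀ := t₀) (bound := fun x => M * ‖h x‖) (Metric.closedBall_mem_nhds t₀ ε0)
    (Eventually.of_forall fun t => (hmeas hfm t).mul hh.aestronglyMeasurable)
    (hh.bdd_mul (c := M₀) (hmeas hfm t₀) (by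
      filter_upwards [hu] with x hx using hM₀ _ (hmem _ ht₀' _ hx)))
    (((hmeas (measurable_deriv f) t₀).mul
      (measurable_ofReal.comp hum).aestronglyMeasurable).mul hh.aestronglyMeasurable)
    (by
      filter_upwards [hu] with x hx t ht
      have h1 := hM _ (hmem _ ht _ hx)
      have h2 : ‖((u x : ℝ) : ℂ)‖ ≤ 1 := by
        rw [norm_real, Real.norm_of_nonneg hx.1]; exact hx.2
      rw [norm_mul, norm_mul]
      gcongr
      nlinarith [norm_nonneg (deriv f (t * u x)), norm_nonneg ((u x : ℝ) : ℂ)])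
    (hh.norm.const_mul M)
    (by
      filter_upwards [hu] with x hx t ht
      have hd : HasDerivAt f (deriv f (t * u x)) (t * u x) :=
        (hf.differentiableAt (hU.mem_nhds (hstar _ (hε ht) _ hx))).hasDerivAt
      have := (hd.comp t ((hasDerivAt_id t).mul_const (u x : ℂ))).mul_const (h x)
      simpa using! this)
  exact key.2.differentiableAt.differentiableWithinAt

/-- The kernel, a product of a polynomial and a complex power, whose Taylor coefficients at `0`
are the homogeneous parts of the double binomial series at `(χ, ζ)`, see `hasSum_binomTerm`. -/
def f5Kernel (α : ℝ) (m : ℕ) (χ ζ s : ℂ) : ℂ :=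
  (1 - s * ζ) ^ m * (1 - s * (χ + ζ)) ^ (-(α + m : ℂ))

theorem measurable_f5Kernel (α : ℝ) (m : ℕ) (χ ζ : ℂ) : Measurable (f5Kernel α m χ ζ) := by
  unfold f5Kernel
  fun_prop

theorem differentiableOn_f5Kernel (α : ℝ) (m : ℕ) (χ ζ : ℂ) :
    DifferentiableOn ℂ (f5Kernel α m χ ζ) {s | 0 < (1 - s * (χ + ζ)).re} := by
  intro s hs
  have h1 : DifferentiableAt ℂ (fun s : ℂ => (1 - s * (χ + ζ)) ^ (-(α + m : ℂ))) s :=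
    DifferentiableAt.cpow_const (by fun_prop) (Or.inl hs)
  have h2 : DifferentiableAt ℂ (fun s : ℂ => (1 - s * ζ) ^ m) s := by fun_prop
  exact (h2.mul h1).differentiableWithinAt

theorem isOpen_kernelDomain (w : ℂ) : IsOpen {s : ℂ | 0 < (1 - s * w).re} :=
  isOpen_lt continuous_const (by fun_prop)

theorem kernelDomain_star {w t : ℂ} (ht : 0 < (1 - t * w).re) {r : ℝ}
    (hr : r ∈ Set.Icc (0 : ℝ) 1) : 0 < (1 - t * r * w).re := by
  have e : (1 - t * r * w).re = (1 - r) + r * (1 - t * w).re := by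
    rw [show 1 - t * r * w = ((1 - r : ℝ) : ℂ) + (r : ℂ) * (1 - t * w) by push_cast; ring,
      add_re, ofReal_re, re_ofReal_mul]
  rw [e]
  rcases hr.1.eq_or_lt with rfl | h0
  · simp
  · have := mul_pos h0 ht
    linarith [hr.2]

theorem segment_subset_kernelDomain {w : ℂ} (hw : 0 < (1 - w).re) :
    segment ℝ (0 : ℂ) 1 ⊆ {s : ℂ | 0 < (1 - s * w).re} := by
  rw [segment_eq_image]
  rintro _ ⟨r, hr, rfl⟩
  simpa using kernelDomain_star (t := 1) (w := w) (by simpa using hw) hr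

theorem binomTerm_mul (α β x y s : ℂ) (p : ℕ × ℕ) :
    binomTerm α β (s * x) (s * y) p = s ^ (p.1 + p.2) * binomTerm α β x y p := by
  simp only [binomTerm, mul_pow, pow_add]
  ring

/-- The terms of `F₅` are those of the double binomial series with the coefficient of total degree
`n` multiplied by `(c)_n (d)_n / ((e)_n (α)_n)`. -/
theorem f5Term_eq {α : ℝ} (hα : 0 < α) (c d e β χ ζ : ℂ) (p : ℕ × ℕ) :
    f5Term c d e β α χ ζ p =
      poch c (p.1 + p.2) * poch d (p.1 + p.2) / (poch e (p.1 + p.2) * poch α (p.1 + p.2)) *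
        binomTerm α β χ ζ p := by
  have h1 : poch (α : ℂ) p.1 ≠ 0 := poch_ne_zero (by simpa) _
  have h2 : poch (α + p.1 : ℂ) p.2 ≠ 0 := poch_ne_zero (by simp; positivity) _
  rw [f5Term, binomTerm, poch_add (α : ℂ)]
  field_simp

/-- If `(c)_n (d)_n / ((e)_n (α)_n)` are the moments of a density on `[0, 1]`, then the integral of
the dilated kernel against this density continues `F₅`. -/
theorem isF5Continuation_of_moments (hum : Measurable u) (hu : ∀ᵐ x ∂ν, u x ∈ Set.Icc (0 : ℝ) 1)
    (hh : Integrable h ν) {α : ℝ} (hα : 0 < α) (m : ℕ) {c d e χ ζ : ℂ}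
    (hmom : ∀ n : ℕ, ∫ x, (u x : ℂ) ^ n * h x ∂ν = poch c n * poch d n / (poch e n * poch α n))
    (hre : 0 < (1 - (χ + ζ)).re) :
    IsF5Continuation c d e (α + m) α χ ζ (fun t => ∫ x, f5Kernel α m χ ζ (t * u x) * h x ∂ν) := by
  have hd := differentiableOn_integral_comp_mul hum hu hh (measurable_f5Kernel α m χ ζ)
    (isOpen_kernelDomain (χ + ζ)) (fun t ht r hr => kernelDomain_star ht hr)
    (differentiableOn_f5Kernel α m χ ζ)
  refine ⟨(hd.analyticOnNhd (isOpen_kernelDomain _)).mono (segment_subset_kernelDomain hre), ?_⟩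
  have hsmall : ∀ᶠ t in 𝓝 (0 : ℂ), ‖t * χ‖ + ‖t * ζ‖ < 1 := by
    have hc : ContinuousAt (fun t : ℂ => ‖t * χ‖ + ‖t * ζ‖) 0 := by fun_prop
    exact hc.eventually_lt continuousAt_const (by simp)
  filter_upwards [hsmall] with t ht
  have hsum : Summable fun p => ‖binomTerm α (α + m) (t * χ) (t * ζ) p‖ := by
    have := summable_norm_binomTerm hα.le (show (0 : ℝ) ≤ α + m by positivity) ht
    push_cast at this
    exact this
  have hnorm : ∀ᵐ x ∂ν, ∀ n : ℕ, ‖(u x : ℂ) ^ n‖ ≤ 1 := by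
    filter_upwards [hu] with x hx n
    rw [norm_pow, norm_real, Real.norm_of_nonneg hx.1]
    exact pow_le_one₀ hx.1 hx.2
  have hint : ∀ n : ℕ, Integrable (fun x => (u x : ℂ) ^ n * h x) ν := fun n =>
    hh.bdd_mul (c := 1) ((measurable_ofReal.comp hum).pow_const n).aestronglyMeasurable
      (hnorm.mono fun x hx => hx n)
  have hI := hasSum_integral_of_summable_integral_norm (μ := ν)
    (F := fun (p : ℕ × ℕ) x =>
      binomTerm α (α + m) (t * χ) (t * ζ) p * ((u x : ℂ) ^ (p.1 + p.2) * h x))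
    (fun p => (hint _).const_mul _) (by
      refine Summable.of_nonneg_of_le (fun p => integral_nonneg fun x => norm_nonneg _)
        (fun p => ?_) (hsum.mul_right (∫ x, ‖h x‖ ∂ν))
      rw [← integral_const_mul]
      refine integral_mono_ae ((hint _).const_mul _).norm (hh.norm.const_mul _) ?_
      filter_upwards [hnorm] with x hx
      simp only [norm_mul]
      gcongr
      exact mul_le_of_le_one_left (norm_nonneg _) (hx _))
  convert! hI using 1
  · ext p
    rw [integral_const_mul, hmom, f5Term_eq hα, mul_comm]
  · refine integral_congr_ae ?_
    filter_upwards [hu] with x hx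
    have hx1 : ‖(u x : ℂ)‖ ≤ 1 := by
      rw [norm_real, Real.norm_of_nonneg hx.1]; exact hx.2
    have hlt : ‖u x * (t * χ)‖ + ‖u x * (t * ζ)‖ < 1 := by
      rw [norm_mul _ (t * χ), norm_mul _ (t * ζ), ← mul_add]
      exact (mul_le_of_le_one_left (by positivity) hx1).trans_lt ht
    have hS := (hasSum_binomTerm hα.le m hlt).mul_right (h x)
    simp only [binomTerm_mul (s := (u x : ℂ))] at hS
    have hS' := hS.tsum_eq
    have e : f5Kernel α m χ ζ (t * u x) = (1 - u x * (t * ζ)) ^ m *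
        (1 - (u x * (t * χ) + u x * (t * ζ))) ^ (-(α + m : ℂ)) := by
      rw [f5Kernel]
      congr 2 <;> ring
    rw [e, ← hS']
    exact tsum_congr fun p => by ring

end Moments

/-! ### Beta densities and their moments -/

/-- The density of the (complex) beta distribution with parameters `a`, `b` on `(0, 1)`. -/
def betaDensity (a b : ℂ) (x : ℝ) : ℂ :=
  (betaIntegral a b)⁻¹ * ((x : ℂ) ^ (a - 1) * (1 - (x : ℂ)) ^ (b - 1))

theorem Gamma_add_natCast {a : ℂ} (ha : 0 < a.re) (n : ℕ) :
    Gamma (a + n) = poch a n * Gamma a := by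
  induction n with
  | zero => simp [poch_zero]
  | succ n ih =>
    have h0 : a + n ≠ 0 := fun h => by
      have := congrArg re h
      simp at this
      have : (0 : ℝ) ≤ n := n.cast_nonneg
      linarith
    rw [Nat.cast_succ, ← add_assoc, Gamma_add_one _ h0, ih, poch_succ]
    ring

theorem integrableOn_betaDensity {a b : ℂ} (ha : 0 < a.re) (hb : 0 < b.re) :
    Integrable (betaDensity a b) (volume.restrict (Set.Ioc 0 1)) := by
  have := (intervalIntegrable_iff_integrableOn_Ioc_of_le zero_le_one).1
    (betaIntegral_convergent ha hb)
  exact this.const_mul _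

theorem integral_pow_mul_betaDensity {a b : ℂ} (ha : 0 < a.re) (hb : 0 < b.re) (n : ℕ) :
    ∫ x in Set.Ioc (0 : ℝ) 1, (x : ℂ) ^ n * betaDensity a b x = poch a n / poch (a + b) n := by
  have hab : 0 < (a + b).re := by simpa using add_pos ha hb
  have han : 0 < (a + n).re := by simp; positivity
  have h1 : ∫ x in Set.Ioc (0 : ℝ) 1, (x : ℂ) ^ n * betaDensity a b x =
      (betaIntegral a b)⁻¹ * betaIntegral (a + n) b := by
    rw [betaIntegral.eq_1 (a + n), intervalIntegral.integral_of_le zero_le_one,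
      ← integral_const_mul]
    refine setIntegral_congr_fun measurableSet_Ioc fun x hx => ?_
    have hx0 : (x : ℂ) ≠ 0 := by exact_mod_cast hx.1.ne'
    rw [betaDensity, show a + n - 1 = (a - 1) + n by ring, cpow_add _ _ hx0, cpow_natCast]
    ring
  rw [h1, betaIntegral_eq_Gamma_mul_div _ _ ha hb, betaIntegral_eq_Gamma_mul_div _ _ han hb,
    add_right_comm, Gamma_add_natCast ha, Gamma_add_natCast hab]
  have := Gamma_ne_zero_of_re_pos ha
  have := Gamma_ne_zero_of_re_pos hb
  have := Gamma_ne_zero_of_re_pos hab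
  have := poch_ne_zero hab n
  field_simp

/-- Lebesgue measure on the unit square. -/
def squareMeasure : Measure (ℝ × ℝ) :=
  (volume.restrict (Set.Ioc 0 1)).prod (volume.restrict (Set.Ioc 0 1))

theorem ae_squareMeasure_mul_mem :
    ∀ᵐ p ∂squareMeasure, p.1 * p.2 ∈ Set.Icc (0 : ℝ) 1 := by
  rw [squareMeasure, Measure.prod_restrict]
  filter_upwards [ae_restrict_mem (measurableSet_Ioc.prod measurableSet_Ioc)] with p hp
  exact ⟨mul_nonneg hp.1.1.le hp.2.1.le, mul_le_one₀ hp.1.2 hp.2.1.le hp.2.2⟩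

theorem integrable_betaDensity_mul {a b c d : ℂ} (ha : 0 < a.re) (hb : 0 < b.re)
    (hc : 0 < c.re) (hd : 0 < d.re) :
    Integrable (fun p : ℝ × ℝ => betaDensity a b p.1 * betaDensity c d p.2) squareMeasure :=
  (integrableOn_betaDensity ha hb).mul_prod (integrableOn_betaDensity hc hd)

/-- The product of two independent beta variables has the products of the moments as moments. -/
theorem integral_mul_pow_mul_betaDensity {a b c d : ℂ} (ha : 0 < a.re) (hb : 0 < b.re)
    (hc : 0 < c.re) (hd : 0 < d.re) (n : ℕ) :
    ∫ p : ℝ × ℝ, ((p.1 * p.2 : ℝ) : ℂ) ^ n * (betaDensity a b p.1 * betaDensity c d p.2)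
      ∂squareMeasure = poch a n * poch c n / (poch (c + d) n * poch (a + b) n) := by
  have h := integral_prod_mul (μ := volume.restrict (Set.Ioc (0 : ℝ) 1))
    (ν := volume.restrict (Set.Ioc (0 : ℝ) 1)) (fun x => (x : ℂ) ^ n * betaDensity a b x)
    (fun x => (x : ℂ) ^ n * betaDensity c d x)
  rw [integral_pow_mul_betaDensity ha hb, integral_pow_mul_betaDensity hc hd, div_mul_div_comm,
    mul_comm (poch (a + b) n)] at h
  rw [← h]
  refine integral_congr_ae (Eventually.of_forall fun p => ?_)
  push_cast
  ring

/-! ### Generating functions on the disk -/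

theorem prod_range_sub_eq_choose (m i : ℕ) :
    ∏ j ∈ Finset.range i, ((m : ℝ) - i + 1 + j) = (i.factorial : ℝ) * (m.choose i : ℝ) := by
  rw [← Nat.cast_mul, ← Nat.descFactorial_eq_factorial_mul_choose,
    ← descPochhammer_eval_eq_descFactorial ℝ, descPochhammer_eval_eq_prod_range,
    ← Finset.prod_range_reflect]
  refine Finset.prod_congr rfl fun j hj => ?_
  have hj := Finset.mem_range.1 hj
  rw [Nat.cast_sub (by lia), Nat.cast_sub (by lia)]
  push_cast
  ring

theorem poch_neg_natCast (k j : ℕ) :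
    poch (-(k : ℂ)) j = (-1) ^ j * ((j.factorial : ℂ) * (k.choose j : ℂ)) := by
  rw [← Nat.cast_mul, ← Nat.descFactorial_eq_factorial_mul_choose,
    ← descPochhammer_eval_eq_descFactorial ℂ, descPochhammer_eval_eq_prod_range, poch]
  rw [← Finset.card_range j, ← Finset.prod_const, Finset.card_range, ← Finset.prod_mul_distrib]
  exact Finset.prod_congr rfl fun i _ => by ring

/-- The Taylor coefficient of order `k` at `0` of `s ↦ (1 - s conj z)^(-b) (z - s)^m`. -/
def diskCoeff (b : ℂ) (m : ℕ) (z : ℂ) (k : ℕ) : ℂ :=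
  ∑ l ∈ Finset.range (k + 1), (poch b l / (l.factorial : ℂ) * conj z ^ l) *
    ((-1) ^ (k - l) * z ^ (m - (k - l)) * (m.choose (k - l) : ℂ))

/-- Valid at `z = 0` as well, where both sides reduce to `(-1)^m` for `k = m` and vanish otherwise. -/
theorem zpow_mul_jacobiP_eq_diskCoeff (γ : ℝ) (m k : ℕ) (z : ℂ) :
    (-1) ^ k * z ^ ((m : ℤ) - (k : ℤ)) *
      (jacobiP k ((m : ℝ) - k) (2 * γ - 1) (1 - 2 * ‖z‖ ^ 2) : ℂ) =
    diskCoeff (2 * γ + m) m z k := by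
  rw [jacobiP, ofReal_sum, Finset.mul_sum, diskCoeff]
  refine Finset.sum_congr rfl fun l hl => ?_
  obtain ⟨i, rfl⟩ := Nat.exists_eq_add_of_le (Nat.lt_succ_iff.1 (Finset.mem_range.1 hl))
  have e1 : ∏ j ∈ Finset.range l,
      (((l + i : ℕ) : ℝ) + ((m : ℝ) - (l + i : ℕ)) + (2 * γ - 1) + 1 + j) =
      ∏ j ∈ Finset.range l, (2 * γ + m + j) :=
    Finset.prod_congr rfl fun j _ => by ring
  have e2 : ∏ j ∈ Finset.range i, ((m : ℝ) - (l + i : ℕ) + l + 1 + j) =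
      (i.factorial : ℝ) * (m.choose i : ℝ) := by
    rw [← prod_range_sub_eq_choose]
    exact Finset.prod_congr rfl fun j _ => by push_cast; ring
  have e3 : (((1 - 2 * ‖z‖ ^ 2 - 1) / 2 : ℝ) : ℂ) = -(z * conj z) := by
    rw [mul_conj, normSq_eq_norm_sq]
    push_cast
    ring
  have e4 : (((∏ j ∈ Finset.range l, (2 * γ + m + j) : ℝ)) : ℂ) = poch (2 * γ + m) l := by
    simp [poch]
  have hi : (i.factorial : ℂ) ≠ 0 := by exact_mod_cast i.factorial_ne_zero
  rw [Nat.add_sub_cancel_left, e1, e2, ofReal_mul, ofReal_pow, e3, ofReal_div, ofReal_mul, e4]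
  push_cast
  by_cases him : i ≤ m
  · obtain ⟨r, rfl⟩ := Nat.exists_eq_add_of_le him
    have hz : z ^ (((i + r : ℕ) : ℤ) - (l + i : ℤ)) * (z * conj z) ^ l = z ^ r * conj z ^ l := by
      rcases eq_or_ne z 0 with rfl | h0
      -- For `l > 0` both sides vanish, whatever the value of `0 ^ (r - l)`.
      · rcases l.eq_zero_or_pos with rfl | hl
        · simp
        · simp [hl.ne']
      · rw [mul_pow, ← mul_assoc, ← zpow_natCast z l, ← zpow_add₀ h0, ← zpow_natCast z r]
        congr 2
        push_cast
        ring
    have hs : (-1 : ℂ) ^ (l + i) * (-1) ^ l = (-1) ^ i := by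
      rw [pow_add, mul_right_comm, ← mul_pow]; simp
    rw [Nat.add_sub_cancel_left, neg_pow (z * conj z)]
    calc _ = ((-1 : ℂ) ^ (l + i) * (-1) ^ l) * (z ^ (((i + r : ℕ) : ℤ) - (l + i : ℤ)) *
          (z * conj z) ^ l) * (poch (2 * γ + (i + r : ℕ)) l / (l.factorial : ℂ) *
          ((i + r).choose i : ℂ)) := by field_simp
      _ = _ := by rw [hs, hz]; ring
  · rw [Nat.choose_eq_zero_of_lt (not_le.1 him)]
    simp

theorem summable_norm_diskFactor {b : ℝ} (hb : 0 ≤ b) {z : ℂ} (hz : ‖z‖ < 1) {s : ℂ}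
    (hs : ‖s‖ ≤ 1) : Summable fun l : ℕ => ‖poch b l / (l.factorial : ℂ) * (s * conj z) ^ l‖ := by
  refine summable_norm_poch hb ?_
  rw [norm_mul, norm_conj]
  exact (mul_le_of_le_one_left (norm_nonneg _) hs).trans_lt hz

theorem hasSum_sub_pow (m : ℕ) (z s : ℂ) :
    HasSum (fun i : ℕ => (-s) ^ i * z ^ (m - i) * (m.choose i : ℂ)) ((z - s) ^ m) := by
  have h : HasSum (fun i : ℕ => (-s) ^ i * z ^ (m - i) * (m.choose i : ℂ))
      (∑ i ∈ Finset.range (m + 1), (-s) ^ i * z ^ (m - i) * (m.choose i : ℂ)) :=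
    hasSum_sum_of_ne_finset_zero fun i hi => by
      rw [Nat.choose_eq_zero_of_lt (by simpa using hi)]
      simp
  rwa [← add_pow, neg_add_eq_sub] at h

theorem summable_norm_sub_pow (m : ℕ) (z s : ℂ) :
    Summable fun i : ℕ => ‖(-s) ^ i * z ^ (m - i) * (m.choose i : ℂ)‖ := by
  refine summable_of_ne_finset_zero (s := Finset.range (m + 1)) fun i hi => ?_
  rw [Nat.choose_eq_zero_of_lt (by simpa using hi)]
  simp

theorem diskCoeff_mul_pow (b : ℂ) (m : ℕ) (z s : ℂ) (k : ℕ) :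
    diskCoeff b m z k * s ^ k = ∑ l ∈ Finset.range (k + 1),
      (poch b l / (l.factorial : ℂ) * (s * conj z) ^ l) *
        ((-s) ^ (k - l) * z ^ (m - (k - l)) * (m.choose (k - l) : ℂ)) := by
  rw [diskCoeff, Finset.sum_mul]
  refine Finset.sum_congr rfl fun l hl => ?_
  obtain ⟨i, rfl⟩ := Nat.exists_eq_add_of_le (Nat.lt_succ_iff.1 (Finset.mem_range.1 hl))
  rw [Nat.add_sub_cancel_left, neg_pow s, mul_pow, pow_add]
  ring

/-- The generating function of the `diskCoeff`, as a Cauchy product. -/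
theorem hasSum_diskCoeff {b : ℝ} (hb : 0 ≤ b) (m : ℕ) {z : ℂ} (hz : ‖z‖ < 1) {s : ℂ}
    (hs : ‖s‖ ≤ 1) : HasSum (fun k => diskCoeff b m z k * s ^ k)
      ((1 - s * conj z) ^ (-(b : ℂ)) * (z - s) ^ m) := by
  have hsz : ‖s * conj z‖ < 1 := by
    rw [norm_mul, norm_conj]
    exact (mul_le_of_le_one_left (norm_nonneg _) hs).trans_lt hz
  simp only [diskCoeff_mul_pow]
  have h := hasSum_sum_range_mul_of_summable_norm (summable_norm_diskFactor hb hz hs)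
    (summable_norm_sub_pow m z s)
  rwa [(hasSum_poch (b : ℂ) hsz).tsum_eq, (hasSum_sub_pow m z s).tsum_eq] at h

theorem summable_norm_diskCoeff {b : ℝ} (hb : 0 ≤ b) (m : ℕ) {z : ℂ} (hz : ‖z‖ < 1) :
    Summable fun k => ‖diskCoeff b m z k‖ := by
  have h := summable_norm_sum_mul_range_of_summable_norm
    (summable_norm_diskFactor hb hz (s := 1) (by simp)) (summable_norm_sub_pow m z 1)
  simpa only [← diskCoeff_mul_pow, one_pow, mul_one] using h

/-! ### The coherent state series as an integral -/

section Moments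

variable {X : Type*} [MeasurableSpace X] {ν : Measure X} {u : X → ℝ} {h : X → ℂ}

/-- The terminating `₃F₂`-series is the `k`-th difference `∑ j, (-1)^j (k choose j) A_j` of the
moment sequence `A`, which is the moment of `(1 - u)^k`. -/
theorem dualHahn_eq_integral (hum : Measurable u) (hu : ∀ᵐ x ∂ν, u x ∈ Set.Icc (0 : ℝ) 1)
    (hh : Integrable h ν) {γ ξ : ℝ}
    (hmom : ∀ n : ℕ, ∫ x, (u x : ℂ) ^ n * h x ∂ν =
      poch (γ + I * ξ) n * poch (γ - I * ξ) n / (poch (γ + 1 / 2) n * poch (2 * γ) n)) (k : ℕ) :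
    dualHahn k ξ γ γ (1 / 2) =
      poch (2 * γ) k * poch (γ + 1 / 2) k * ∫ x, (1 - u x : ℂ) ^ k * h x ∂ν := by
  have hint : ∀ n : ℕ, Integrable (fun x => (u x : ℂ) ^ n * h x) ν := fun n =>
    integrable_comp_mul hum hu hh (f := fun s => s ^ n) (by fun_prop) (by fun_prop)
  have e : ∀ x, (1 - u x : ℂ) ^ k * h x =
      ∑ j ∈ Finset.range (k + 1), ((-1) ^ j * (k.choose j : ℂ)) * ((u x : ℂ) ^ j * h x) := by
    intro x
    rw [sub_eq_neg_add, add_pow, Finset.sum_mul]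
    refine Finset.sum_congr rfl fun j _ => ?_
    rw [neg_pow, one_pow]
    ring
  simp only [e]
  rw [integral_finsetSum _ fun j _ => (hint j).const_mul _, dualHahn]
  simp only [integral_const_mul, hmom]
  push_cast
  rw [← two_mul]
  congr 1
  refine Finset.sum_congr rfl fun j _ => ?_
  have hj : (j.factorial : ℂ) ≠ 0 := by exact_mod_cast j.factorial_ne_zero
  rw [poch_neg_natCast]
  field_simp

theorem hasSum_diskCoeff_mul_integral (hum : Measurable u)
    (hu : ∀ᵐ x ∂ν, u x ∈ Set.Icc (0 : ℝ) 1)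
    (hh : Integrable h ν) {b : ℝ} (hb : 0 ≤ b) (m : ℕ) {z : ℂ} (hz : ‖z‖ < 1) :
    HasSum (fun k => diskCoeff b m z k * ∫ x, (1 - u x : ℂ) ^ k * h x ∂ν)
      (∫ x, (1 - (1 - u x) * conj z) ^ (-(b : ℂ)) * (z - (1 - u x)) ^ m * h x ∂ν) := by
  have hint : ∀ k : ℕ, Integrable (fun x => (1 - u x : ℂ) ^ k * h x) ν := fun n =>
    integrable_comp_mul hum hu hh (f := fun s => (1 - s) ^ n) (by fun_prop) (by fun_prop)
  have hle : ∀ᵐ x ∂ν, ‖(1 - u x : ℂ)‖ ≤ 1 := by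
    filter_upwards [hu] with x hx
    rw [← ofReal_one, ← ofReal_sub, norm_real, Real.norm_of_nonneg (by linarith [hx.2])]
    linarith [hx.1]
  have hI := hasSum_integral_of_summable_integral_norm (μ := ν)
    (F := fun (k : ℕ) x => diskCoeff b m z k * ((1 - u x : ℂ) ^ k * h x))
    (fun k => (hint k).const_mul _) (by
      refine Summable.of_nonneg_of_le (fun p => integral_nonneg fun x => norm_nonneg _)
        (fun p => ?_) ((summable_norm_diskCoeff hb m hz).mul_right (∫ x, ‖h x‖ ∂ν))
      rw [← integral_const_mul]
      refine integral_mono_ae ((hint _).const_mul _).norm (hh.norm.const_mul _) ?_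
      filter_upwards [hle] with x hx
      simp only [norm_mul, norm_pow]
      gcongr
      exact mul_le_of_le_one_left (norm_nonneg _) (pow_le_one₀ (norm_nonneg _) hx))
  convert! hI using 1
  · ext k
    rw [integral_const_mul]
  · refine integral_congr_ae ?_
    filter_upwards [hle] with x hx
    rw [← ((hasSum_diskCoeff hb m hz hx).mul_right (h x)).tsum_eq]
    exact tsum_congr fun k => by ring

end Moments

/-! ### Identification of the integrand and of the constants -/

theorem one_sub_conj_ne_zero {z : ℂ} (hz : ‖z‖ < 1) : 1 - conj z ≠ 0 := fun h => by
  have := re_one_sub_pos (y := conj z) (by simpa using hz)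
  simp [h] at this

theorem f5Args_add {z : ℂ} (hz : ‖z‖ < 1) :
    (1 - z * conj z) / ((1 - z) * (conj z - 1)) + 1 / (1 - z) = -(conj z / (1 - conj z)) := by
  have h1 : 1 - z ≠ 0 := fun h => by
    have := re_one_sub_pos hz
    simp [h] at this
  have h2 := one_sub_conj_ne_zero hz
  have h3 : conj z - 1 ≠ 0 := fun h => h2 (by rw [← neg_sub, h, neg_zero])
  rw [show conj z - 1 = -(1 - conj z) by ring]
  field_simp
  ring

/-- By `f5Args_add` the number is `1 - (χ + ζ)`; it equals `1 / (1 - conj z)`. -/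
theorem re_one_add_div_pos {z : ℂ} (hz : ‖z‖ < 1) : 0 < (1 - -(conj z / (1 - conj z))).re := by
  have h2 := one_sub_conj_ne_zero hz
  rw [show 1 - -(conj z / (1 - conj z)) = (1 - conj z)⁻¹ by field_simp; ring, inv_re]
  exact div_pos (re_one_sub_pos (by simpa using hz)) (normSq_pos.2 h2)

theorem disk_eq_f5Kernel {z : ℂ} (hz : ‖z‖ < 1) (γ : ℝ) (m : ℕ) {r : ℝ}
    (hr : r ∈ Set.Icc (0 : ℝ) 1) :
    (1 - (1 - r) * conj z) ^ (-((2 * γ + m : ℝ) : ℂ)) * (z - (1 - r)) ^ m =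
      (1 - conj z) ^ (-(2 * γ + m : ℂ)) * (z - 1) ^ m *
        f5Kernel (2 * γ) m ((1 - z * conj z) / ((1 - z) * (conj z - 1))) (1 / (1 - z)) r := by
  have h1 : 1 - z ≠ 0 := fun h => by
    have := re_one_sub_pos hz
    simp [h] at this
  have h2 := one_sub_conj_ne_zero hz
  have hpos := kernelDomain_star (t := 1) (w := -(conj z / (1 - conj z)))
    (by simpa using re_one_add_div_pos hz) hr
  rw [one_mul] at hpos
  rw [f5Kernel, f5Args_add hz,
    show 1 - (1 - r) * conj z = (1 - conj z) * (1 - r * -(conj z / (1 - conj z))) by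
      field_simp; ring,
    mul_cpow_of_re_pos (re_one_sub_pos (by simpa using hz)) hpos,
    show z - (1 - r) = (z - 1) * (1 - r * (1 / (1 - z))) by field_simp; ring, mul_pow]
  push_cast
  ring

/-- The factor of `coherentTerm` that does not depend on the index `k`. -/
def coherentConst (c γ : ℝ) (m : ℕ) (z : ℂ) (ξ : ℝ) : ℂ :=
  (Real.sqrt ((2 * γ - 1) * Real.Gamma (m + 2 * γ) / (Real.pi * (m.factorial : ℝ))) : ℂ) /
      ((1 - ‖z‖ ^ 2 : ℝ) : ℂ) ^ m *
    ((Real.sqrt 2 : ℂ) * I ^ (γ : ℂ) * ((c ^ (-4 : ℤ) : ℝ) : ℂ) ^ (I * ξ) *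
      Complex.Gamma (γ + I * ξ) ^ 2 * (Complex.Gamma (I * ξ))⁻¹) /
    ((Real.Gamma (2 * γ) * Real.Gamma (γ + 1 / 2) : ℝ) : ℂ)

theorem sqrt_div_mul_sqrt {A B F G : ℝ} (hF : 0 < F) (hG : 0 < G) :
    Real.sqrt (A * F / (B * G)) / Real.sqrt (F * G) = Real.sqrt (A / B) / G := by
  rw [← Real.sqrt_div' _ (by positivity)]
  nth_rewrite 3 [← Real.sqrt_sq hG.le]
  rw [← Real.sqrt_div' _ (by positivity)]
  congr 1
  field_simp

theorem conj_maassBasis {γ σ : ℝ} {m : ℕ} (hσ : σ = 2 * (m + γ)) (z : ℂ) (k : ℕ) :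
    conj (maassBasis σ m k z) =
      (Real.sqrt ((2 * γ - 1) * Real.Gamma (m + 2 * γ) * (k.factorial : ℝ) /
        (Real.pi * (m.factorial : ℝ) * Real.Gamma (k + 2 * γ))) : ℂ) /
        ((1 - ‖z‖ ^ 2 : ℝ) : ℂ) ^ m * diskCoeff ((2 * γ + m : ℝ) : ℂ) m z k := by
  have e1 : σ - 2 * m - 1 = 2 * γ - 1 := by rw [hσ]; ring
  have e2 : σ - m = m + 2 * γ := by rw [hσ]; ring
  have e3 : σ - 2 * m + k = k + 2 * γ := by rw [hσ]; ring
  rw [maassBasis, e1, e2, e3, show ((2 * γ + m : ℝ) : ℂ) = 2 * γ + m by push_cast; rfl,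
    ← zpow_mul_jacobiP_eq_diskCoeff]
  simp only [map_mul, map_div₀, map_pow, map_zpow₀, map_neg, map_one, conj_conj, conj_ofReal]
  ring

theorem coherentTerm_eq {c γ σ : ℝ} (hγ : 0 < γ) {m : ℕ} (hσ : σ = 2 * (m + γ)) (z : ℂ) (ξ : ℝ)
    {k : ℕ} {M : ℂ}
    (hM : dualHahn k ξ γ γ (1 / 2) = poch (2 * γ) k * poch (γ + 1 / 2) k * M) :
    coherentTerm c γ σ m z ξ k =
      coherentConst c γ m z ξ * (diskCoeff ((2 * γ + m : ℝ) : ℂ) m z k * M) := by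
  have hG : 0 < Real.Gamma (k + 2 * γ) := Real.Gamma_pos_of_pos (by positivity)
  have hk : (0 : ℝ) < k.factorial := by positivity
  have hs := sqrt_div_mul_sqrt (A := (2 * γ - 1) * Real.Gamma (m + 2 * γ))
    (B := Real.pi * m.factorial) hk hG
  have g1 : ((Real.Gamma (k + 2 * γ) : ℝ) : ℂ) = poch (2 * γ) k * (Real.Gamma (2 * γ) : ℝ) := by
    rw [← Complex.Gamma_ofReal, ← Complex.Gamma_ofReal, add_comm]
    push_cast
    exact Gamma_add_natCast (by simpa using hγ) k
  have g2 : ((Real.Gamma (k + γ + 1 / 2) : ℝ) : ℂ) =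
      poch (γ + 1 / 2) k * (Real.Gamma (γ + 1 / 2) : ℝ) := by
    rw [← Complex.Gamma_ofReal, ← Complex.Gamma_ofReal, add_assoc, add_comm]
    push_cast
    exact Gamma_add_natCast (by simp; positivity) k
  have p1 : poch (2 * γ : ℂ) k ≠ 0 := poch_ne_zero (by simpa using hγ) k
  have p2 : poch (γ + 1 / 2 : ℂ) k ≠ 0 := poch_ne_zero (by simp; positivity) k
  have n1 : ((Real.Gamma (2 * γ) : ℝ) : ℂ) ≠ 0 := by
    exact_mod_cast (Real.Gamma_pos_of_pos (by positivity)).ne'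
  have n2 : ((Real.Gamma (γ + 1 / 2) : ℝ) : ℂ) ≠ 0 := by
    exact_mod_cast (Real.Gamma_pos_of_pos (by positivity)).ne'
  have hs' : ((Real.sqrt ((2 * γ - 1) * Real.Gamma (m + 2 * γ) * (k.factorial : ℝ) /
        (Real.pi * (m.factorial : ℝ) * Real.Gamma (k + 2 * γ))) : ℝ) : ℂ) =
      (Real.sqrt ((2 * γ - 1) * Real.Gamma (m + 2 * γ) / (Real.pi * (m.factorial : ℝ))) : ℂ) /
        (poch (2 * γ) k * (Real.Gamma (2 * γ) : ℝ)) *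
        ((Real.sqrt ((k.factorial : ℝ) * Real.Gamma (k + 2 * γ)) : ℝ) : ℂ) := by
    rw [← g1, ← ofReal_div, ← ofReal_mul, ← hs, div_mul_cancel₀]
    exact (Real.sqrt_pos.2 (by positivity)).ne'
  have n3 : ((Real.sqrt ((k.factorial : ℝ) * Real.Gamma (k + 2 * γ)) : ℝ) : ℂ) ≠ 0 := by
    exact_mod_cast (Real.sqrt_pos.2 (by positivity)).ne'
  rw [coherentTerm, conj_maassBasis hσ, hs', oscState, hM, coherentConst,
    ofReal_mul (Real.Gamma (k + γ + 1 / 2)), g2, ofReal_mul (Real.Gamma (2 * γ))]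
  generalize ((Real.sqrt ((k.factorial : ℝ) * Real.Gamma (k + 2 * γ)) : ℝ) : ℂ) = R at n3 ⊢
  generalize poch (2 * γ : ℂ) k = p at p1 ⊢
  generalize poch (γ + 1 / 2 : ℂ) k = q at p2 ⊢
  generalize ((Real.Gamma (2 * γ) : ℝ) : ℂ) = G₁ at n1 ⊢
  generalize ((Real.Gamma (γ + 1 / 2) : ℝ) : ℂ) = G₂ at n2 ⊢
  generalize (Real.sqrt 2 : ℂ) * I ^ (γ : ℂ) * ((c ^ (-4 : ℤ) : ℝ) : ℂ) ^ (I * ξ) *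
    Complex.Gamma (γ + I * ξ) ^ 2 * (Complex.Gamma (I * ξ))⁻¹ = T
  generalize diskCoeff _ m z k = Q
  generalize ((Real.sqrt _ : ℝ) : ℂ) = S
  generalize ((1 - ‖z‖ ^ 2 : ℝ) : ℂ) ^ m = W
  field_simp

/-- Collects the real constants: the powers `(1 - ‖z‖²)^(m + γ)` and `(1 - ‖z‖²)^(-m)` combine. -/
theorem normFactor_mul_sqrt {γ σ : ℝ} (hγ : 1 < γ) {m : ℕ} (hσ : σ = 2 * (m + γ)) {z : ℂ}
    (hz : ‖z‖ < 1) :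
    normFactor σ m z ^ (-(1 / 2) : ℝ) *
      (Real.sqrt ((2 * γ - 1) * Real.Gamma (m + 2 * γ) / (Real.pi * (m.factorial : ℝ))) /
        (1 - ‖z‖ ^ 2) ^ m * Real.sqrt 2) =
      Real.sqrt (2 * Real.Gamma (m + 2 * γ)) / Real.sqrt (m.factorial : ℝ) *
        (1 - ‖z‖ ^ 2) ^ γ := by
  have hx : 0 < 1 - ‖z‖ ^ 2 := by nlinarith [norm_nonneg z]
  have hG : 0 < Real.Gamma (m + 2 * γ) := Real.Gamma_pos_of_pos (by positivity)
  have h2 : 0 < 2 * γ - 1 := by linarith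
  have hm : (0 : ℝ) < m.factorial := by positivity
  have hpi := Real.pi_pos
  have e1 : σ - 2 * m - 1 = 2 * γ - 1 := by rw [hσ]; ring
  have e : normFactor σ m z ^ (-(1 / 2) : ℝ) =
      Real.sqrt (Real.pi / (2 * γ - 1)) * ((1 - ‖z‖ ^ 2) ^ m * (1 - ‖z‖ ^ 2) ^ γ) := by
    have hσ2 : (1 - ‖z‖ ^ 2) ^ σ = ((1 - ‖z‖ ^ 2) ^ m * (1 - ‖z‖ ^ 2) ^ γ) ^ 2 := by
      rw [hσ, ← Real.rpow_natCast (1 - ‖z‖ ^ 2) m, ← Real.rpow_add hx, two_mul, Real.rpow_add hx,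
        sq (_ ^ ((m : ℝ) + γ))]
    rw [normFactor, e1, hσ2, Real.rpow_neg (by positivity), ← Real.sqrt_eq_rpow,
      ← Real.sqrt_inv]
    rw [show ((2 * γ - 1) / (Real.pi * ((1 - ‖z‖ ^ 2) ^ m * (1 - ‖z‖ ^ 2) ^ γ) ^ 2))⁻¹ =
      (Real.pi / (2 * γ - 1)) * ((1 - ‖z‖ ^ 2) ^ m * (1 - ‖z‖ ^ 2) ^ γ) ^ 2 by field_simp,
      Real.sqrt_mul (by positivity), Real.sqrt_sq (by positivity)]
  have es : Real.sqrt (Real.pi / (2 * γ - 1)) *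
      Real.sqrt ((2 * γ - 1) * Real.Gamma (m + 2 * γ) / (Real.pi * (m.factorial : ℝ))) *
      Real.sqrt 2 = Real.sqrt (2 * Real.Gamma (m + 2 * γ)) / Real.sqrt (m.factorial : ℝ) := by
    rw [← Real.sqrt_mul (by positivity), ← Real.sqrt_mul (by positivity),
      ← Real.sqrt_div (by positivity)]
    congr 1
    field_simp
  rw [e, ← es]
  field_simp

theorem coherentState_eq_F5 {c γ σ : ℝ} {m : ℕ} {z : ℂ} (ξ : ℝ) (hγ : 1 < γ)
    (hσ : σ = 2 * (m + γ)) (hz : ‖z‖ < 1) :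
    Summable (coherentTerm c γ σ m z ξ) ∧
    F5Defined (γ + I * ξ) (γ - I * ξ) (γ + 1 / 2) (2 * γ + m) (2 * γ)
      ((1 - z * conj z) / ((1 - z) * (conj z - 1))) (1 / (1 - z)) ∧
    coherentState c γ σ m z ξ =
      (Real.sqrt (2 * Real.Gamma (m + 2 * γ)) : ℂ) * I ^ (γ : ℂ) *
          ((c ^ (-4 : ℤ) : ℝ) : ℂ) ^ (I * ξ) /
          ((Real.Gamma (2 * γ) * Real.Gamma (γ + 1 / 2) * Real.sqrt (m.factorial : ℝ) : ℝ) : ℂ) *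
        (Complex.Gamma (γ + I * ξ) ^ 2 * (Complex.Gamma (I * ξ))⁻¹) *
        (((1 - ‖z‖ ^ 2 : ℝ) ^ γ : ℝ) : ℂ) * (1 - conj z) ^ (-2 * γ : ℂ) *
        ((z - 1) / (1 - conj z)) ^ m *
        F5 (γ + I * ξ) (γ - I * ξ) (γ + 1 / 2) (2 * γ + m) (2 * γ)
          ((1 - z * conj z) / ((1 - z) * (conj z - 1))) (1 / (1 - z)) := by
  have hγ0 : 0 < γ := by linarith
  have ha : 0 < (γ + I * ξ : ℂ).re := by simpa using hγ0
  have hb : 0 < (γ - I * ξ : ℂ).re := by simpa using hγ0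
  have hd : 0 < (1 / 2 + I * ξ : ℂ).re := by simp
  set h : ℝ × ℝ → ℂ := fun p => betaDensity (γ + I * ξ) (γ - I * ξ) p.1 *
    betaDensity (γ - I * ξ) (1 / 2 + I * ξ) p.2
  set u : ℝ × ℝ → ℝ := fun p => p.1 * p.2
  have hum : Measurable u := by fun_prop
  have hu := ae_squareMeasure_mul_mem
  have hh : Integrable h squareMeasure :=
    integrable_betaDensity_mul ha hb hb hd
  have hmom : ∀ n : ℕ, ∫ p, (u p : ℂ) ^ n * h p ∂squareMeasure =
      poch (γ + I * ξ) n * poch (γ - I * ξ) n /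
        (poch (γ + 1 / 2) n * poch (2 * γ) n) := by
    intro n
    rw [integral_mul_pow_mul_betaDensity ha hb hb hd,
      show (γ - I * ξ : ℂ) + (1 / 2 + I * ξ) = γ + 1 / 2 by ring,
      show (γ + I * ξ : ℂ) + (γ - I * ξ) = 2 * γ by ring]
  have hF := isF5Continuation_of_moments hum hu hh (α := 2 * γ) (by positivity) m
    (c := γ + I * ξ) (d := γ - I * ξ) (e := γ + 1 / 2)
    (χ := (1 - z * conj z) / ((1 - z) * (conj z - 1))) (ζ := 1 / (1 - z))
    (by push_cast; exact hmom)
    (by rw [f5Args_add hz]; exact re_one_add_div_pos hz)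
  push_cast at hF
  have hterm : coherentTerm c γ σ m z ξ = fun k =>
      coherentConst c γ m z ξ *
        (diskCoeff ((2 * γ + m : ℝ) : ℂ) m z k *
          ∫ p, (1 - u p : ℂ) ^ k * h p ∂squareMeasure) := by
    ext k
    exact coherentTerm_eq hγ0 hσ z ξ
      (dualHahn_eq_integral hum hu hh hmom k)
  have hsum := (hasSum_diskCoeff_mul_integral hum hu hh
    (show 0 ≤ 2 * γ + m by positivity) m hz).mul_left (coherentConst c γ m z ξ)
  rw [← hterm] at hsum
  refine ⟨hsum.summable, ⟨_, hF⟩, ?_⟩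
  have hker : ∫ p, (1 - (1 - u p) * conj z) ^ (-((2 * γ + m : ℝ) : ℂ)) *
        (z - (1 - u p)) ^ m * h p ∂squareMeasure =
      (1 - conj z) ^ (-(2 * γ + m : ℂ)) * (z - 1) ^ m *
        ∫ p, f5Kernel (2 * γ) m ((1 - z * conj z) / ((1 - z) * (conj z - 1)))
          (1 / (1 - z)) (1 * u p) * h p ∂squareMeasure := by
    rw [← integral_const_mul]
    refine integral_congr_ae ?_
    filter_upwards [hu] with p hp
    rw [disk_eq_f5Kernel hz γ m hp, one_mul]
    ring
  have hN := congrArg (fun x : ℝ => (x : ℂ)) (normFactor_mul_sqrt hγ hσ hz)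
  have h2 := one_sub_conj_ne_zero hz
  have hpow : (1 - conj z) ^ (-(2 * γ + m : ℂ)) * (z - 1) ^ m =
      (1 - conj z) ^ (-2 * γ : ℂ) * ((z - 1) / (1 - conj z)) ^ m := by
    rw [neg_add, cpow_add _ _ h2, cpow_neg _ (m : ℂ), cpow_natCast, div_pow, neg_mul]
    ring
  rw [F5_eq hF, coherentState, hsum.tsum_eq, hker, hpow,
    coherentConst]
  simp only [ofReal_mul, ofReal_div, ofReal_pow] at hN ⊢
  generalize ((normFactor σ m z ^ (-(1 / 2) : ℝ) : ℝ) : ℂ) = N at hN ⊢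
  linear_combination (I ^ (γ : ℂ) * ((c ^ (-4 : ℤ) : ℝ) : ℂ) ^ (I * ξ) *
      Complex.Gamma (γ + I * ξ) ^ 2 * (Complex.Gamma (I * ξ))⁻¹ /
      ((Real.Gamma (2 * γ) : ℂ) * (Real.Gamma (γ + 1 / 2) : ℂ)) *
      ((1 - conj z) ^ (-2 * γ : ℂ) * ((z - 1) / (1 - conj z)) ^ m *
        ∫ p, f5Kernel (2 * γ) m ((1 - z * conj z) / ((1 - z) * (conj z - 1)))
          (1 / (1 - z)) (1 * u p) * h p ∂squareMeasure)) * hN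

end RelBargmann

end

theorem proposition5p1 (c γ σ : ℝ) (m : ℕ) (z : ℂ) (ξ : ℝ)
    (hc : 0 < c) (hγ : γ = (1 + Real.sqrt (1 + 2 * c ^ 4)) / 2)
    (hσ : σ = 2 * (m + γ)) (hz : ‖z‖ < 1) (hξ : 0 ≤ ξ) :
    Summable (RelBargmann.coherentTerm c γ σ m z ξ) ∧
    RelBargmann.F5Defined (γ + I * ξ) (γ - I * ξ) (γ + 1 / 2) (2 * γ + m) (2 * γ)
      ((1 - z * conj z) / ((1 - z) * (conj z - 1))) (1 / (1 - z)) ∧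
    RelBargmann.coherentState c γ σ m z ξ =
      (Real.sqrt (2 * Real.Gamma (m + 2 * γ)) : ℂ) * I ^ (γ : ℂ) *
          ((c ^ (-4 : ℤ) : ℝ) : ℂ) ^ (I * ξ) /
          ((Real.Gamma (2 * γ) * Real.Gamma (γ + 1 / 2) * Real.sqrt (m.factorial : ℝ) : ℝ) : ℂ) *
        (Complex.Gamma (γ + I * ξ) ^ 2 * (Complex.Gamma (I * ξ))⁻¹) *
        (((1 - ‖z‖ ^ 2 : ℝ) ^ γ : ℝ) : ℂ) * (1 - conj z) ^ (-2 * γ : ℂ) *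
        ((z - 1) / (1 - conj z)) ^ m *
        RelBargmann.F5 (γ + I * ξ) (γ - I * ξ) (γ + 1 / 2) (2 * γ + m) (2 * γ)
          ((1 - z * conj z) / ((1 - z) * (conj z - 1))) (1 / (1 - z)) := by
  have hγ1 : 1 < γ := by
    have : 1 < Real.sqrt (1 + 2 * c ^ 4) := by
      rw [Real.lt_sqrt zero_le_one]
      have := pow_pos hc 4
      linarith
    rw [hγ]
    linarith
  exact RelBargmann.coherentState_eq_F5 ξ hγ1 hσ hz
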